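/- Let $\Omega\subset\mathbb{C}$ be a bounded, simply connected domain and let $T$ be a biholomorphic map from $\Omega$ onto the open unit disk. Let $\gamma_\Omega(x,y)=G_\Omega(x,y)-\frac1{2\pi}\ln|x-y|$ be the regular part of the Green's function $G_\Omega$ of $\Omega$ (so $\Delta_xG_\Omega(\cdot,y)=\delta_y$ in $\Omega$ and $G_\Omega(\cdot,y)$ vanishes on $\partial\Omega$), and let $\widetilde\gamma_\Omega(x)=\gamma_\Omega(x,x)$ be the Robin function. A single point vortex of mass $1$ starting at $z_0\in\Omega$ is a solution $z:[0,\infty)\to\Omega$ of $z'(t)=\frac12\nabla^\perp\widetilde\gamma_\Omega(z(t))$, $z(0)=z_0$, where $\nabla^\perp=(-\partial_2,\partial_1)$. For a trajectory $z$ and a set $S$, let its exit time from $S$ be $\sup\{t\ge 0:\ z(s)\in S\ \text{for all } s\in[0,t]\}\in[0,\infty]$. Let $x_0\in\Omega$ satisfy $T(x_0)=T''(x_0)=0$. Then $x_0$ is a stationary point, that is, the constant $z(t)=x_0$ is a trajectory, and the following hold. (1) If $|T'''(x_0)|<2|T'(x_0)|^3$, there is a constant $C>0$ such that for every $\beta<1$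 there is $\varepsilon_0>0$ with the following property: for all $0<\varepsilon\le\varepsilon_0$ and all $z_0$ with $|z_0-x_0|\le\varepsilon$, a global trajectory starting at $z_0$ exists, and every such trajectory satisfies $|z(t)-x_0|<C\varepsilon$ for all $t\ge0$, and its exit time $\tau_{\varepsilon,\beta}$ from the open disk $\{|x-x_0|<\varepsilon^\beta\}$ is $+\infty$. (2) If $|T'''(x_0)|>2|T'(x_0)|^3$, there is a constant $C>0$ such that for every $\beta\in(0,1)$ there is $\varepsilon_0>0$ with the following property: for every $0<\varepsilon\le\varepsilon_0$ there is a starting point $z_0$ with $|z_0-x_0|\le\varepsilon$ such that a global trajectory starting at $z_0$ exists, and every such trajectory has exit time $\tau_{\varepsilon,\beta}\le C|\ln\varepsilon|$ from the closed disk $\{|x-x_0|\le\varepsilon^\beta\}$. -/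

import Mathlib

open Set Metric Filter Topology

noncomputable section

/-- `h` is the regular part `γ_Ω(·, y)` of the Green's function of `Ω` with pole `y`: `h` is
harmonic on `Ω`, and `x ↦ (2π)⁻¹ ln |x - y| + h x` (whose Laplacian on `Ω` is therefore the Dirac
mass at `y`) vanishes on the boundary of `Ω`. -/
structure IsGreenRegularPart (Ω : Set ℂ) (y : ℂ) (h : ℂ → ℝ) : Prop where
  harmonic : InnerProductSpace.HarmonicOnNhd h Ω
  boundary : ∀ p ∈ frontier Ω,
    Tendsto (fun x : ℂ => (2 * Real.pi)⁻¹ * Real.log ‖x - y‖ + h x) (𝓝[Ω] p) (𝓝 0)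

open Classical in
/-- The regular part `γ_Ω(x, y)` of the Green's function of a bounded domain `Ω`; by the maximum
principle its values on `Ω × Ω` are determined. It is `0` by convention at a pole `y` where there
is no Green's function. -/
def greenRegularPart (Ω : Set ℂ) (x y : ℂ) : ℝ :=
  if h : ∃ f : ℂ → ℝ, IsGreenRegularPart Ω y f then h.choose x else 0

/-- The Robin function `γ_Ω(x, x)`. -/
def robinFunction (Ω : Set ℂ) (x : ℂ) : ℝ := greenRegularPart Ω x x

/-- The velocity `½ ∇^⊥ (robinFunction Ω)` of a single point vortex of mass one. Here
`v^⊥ = (-v₂, v₁)`, which is `i v` as a complex number. -/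
def vortexVelocity (Ω : Set ℂ) (x : ℂ) : ℂ :=
  (1 / 2 : ℂ) * (Complex.I * gradient (robinFunction Ω) x)

/-- `z`, restricted to `[0, ∞)`, is the trajectory in `Ω` of a single point vortex of mass one. -/
structure IsVortexTrajectory (Ω : Set ℂ) (z : ℝ → ℂ) : Prop where
  mapsTo : MapsTo z (Ici 0) Ω
  isIntegralCurveOn : IsIntegralCurveOn z (fun _ x => vortexVelocity Ω x) (Ici 0)

/-- The exit time `sup {t ≥ 0 : z s ∈ S for all s ∈ [0, t]}` of `z` from `S`, in `[0, ∞]`. -/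
def exitTime (z : ℝ → ℂ) (S : Set ℂ) : ENNReal :=
  ⨆ t ∈ {t : ℝ | 0 ≤ t ∧ ∀ s ∈ Icc 0 t, z s ∈ S}, ENNReal.ofReal t

/-- `T` restricts to a biholomorphic map from the open set `U` onto the open set `V`. -/
def IsBiholomorphism (T : ℂ → ℂ) (U V : Set ℂ) : Prop :=
  DifferentiableOn ℂ T U ∧ MapsTo T U V ∧
    ∃ S : ℂ → ℂ, DifferentiableOn ℂ S V ∧ MapsTo S V U ∧ InvOn S T U V

end

/-! The Riemann map makes the Robin function explicit: `2π·robinFunction = ln|T'| - ln(1 - |T|²)`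
(`robinFunction_eq`). Put `c = T'''(x₀)/T'(x₀)` and `a = |T'(x₀)|²`. As `T(x₀) = T''(x₀) = 0`, the
point `x₀` is critical, and the quadratic part of the Robin function there is `(Re(c w²) +
2a|w|²)/(4π)` (`robinFunction_expansion`). It is positive definite when `|c| < 2a` and indefinite
when `|c| > 2a`; these are the two cases of the theorem.

The motion is Hamiltonian, so the Robin function is conserved. At a nondegenerate minimum its level
sets near `x₀` confine the vortex to distance `O(ε)` (`stability`). At a saddle, a quadratic form
`V(w) = Re(κ w²)` with `|κ| = 1` satisfies `V' ≥ kV` near `x₀`; since `V ≤ |w|²`, a vortex started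
where `V = ε²` leaves exponentially fast (`instability`).

Trajectories are global because the Robin function tends to `+∞` at the boundary, so its sublevel
sets are compact (`isCompact_sublevel_robinFunction`). This blow-up says that the conformal radius
tends to `0`, which follows from a covering theorem, with no regularity of the boundary. -/

open scoped ComplexConjugate

/-! ### Basic properties of biholomorphisms. -/

namespace IsBiholomorphism

variable {T : ℂ → ℂ} {U V : Set ℂ}

lemma analyticAt (hT : IsBiholomorphism T U V) (hU : IsOpen U) {x : ℂ} (hx : x ∈ U) :
    AnalyticAt ℂ T x := hT.1.analyticAt (hU.mem_nhds hx)

lemma injOn (hT : IsBiholomorphism T U V) : InjOn T U := by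
  obtain ⟨-, -, S, -, -, hST⟩ := hT
  exact hST.1.injOn

lemma deriv_ne_zero (hT : IsBiholomorphism T U V) (hU : IsOpen U) (hV : IsOpen V) {x : ℂ}
    (hx : x ∈ U) : deriv T x ≠ 0 := by
  have hTx := (hT.analyticAt hU hx).differentiableAt.hasDerivAt
  obtain ⟨-, hTm, S, hS, -, hST⟩ := hT
  have hSx := (hS.differentiableAt (hV.mem_nhds (hTm hx))).hasDerivAt
  have h1 : HasDerivAt id (deriv S (T x) * deriv T x) x :=
    (hSx.comp x hTx).congr_of_eventuallyEq
      (Filter.eventually_of_mem (hU.mem_nhds hx) fun y hy => (hST.1 hy).symm)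
  have h2 := h1.unique (hasDerivAt_id x)
  intro h0
  simp [h0] at h2

lemma isPreconnected_of_ball (hT : IsBiholomorphism T U (ball 0 1)) : IsPreconnected U := by
  obtain ⟨-, hTm, S, hS, hSm, hST⟩ := hT
  have : U = S '' ball 0 1 := by
    ext x
    exact ⟨fun hx => ⟨T x, hTm hx, hST.1 hx⟩, by rintro ⟨y, hy, rfl⟩; exact hSm hy⟩
  rw [this]
  exact (convex_ball (0 : ℂ) 1).isPreconnected.image _ hS.continuousOn

lemma norm_lt_one (hT : IsBiholomorphism T U (ball 0 1)) {x : ℂ} (hx : x ∈ U) : ‖T x‖ < 1 := by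
  simpa using hT.2.1 hx

lemma one_sub_norm_sq_pos (hT : IsBiholomorphism T U (ball 0 1)) {x : ℂ} (hx : x ∈ U) :
    0 < 1 - ‖T x‖ ^ 2 := by
  have := hT.norm_lt_one hx
  nlinarith [norm_nonneg (T x)]

/-- A biholomorphism onto the unit disk is proper: its modulus tends to one at the boundary. -/
lemma tendsto_norm (hT : IsBiholomorphism T U (ball 0 1)) (hU : IsOpen U) {p : ℂ}
    (hp : p ∈ frontier U) : Tendsto (fun x => ‖T x‖) (𝓝[U] p) (𝓝 1) := by
  have hpU : p ∉ U := fun h => (hU.frontier_eq ▸ hp).2 h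
  have hlt : ∀ᶠ x in 𝓝[U] p, ‖T x‖ < 1 :=
    eventually_of_mem self_mem_nhdsWithin fun x hx => hT.norm_lt_one hx
  obtain ⟨-, -, S, hS, hSm, hST⟩ := hT
  refine tendsto_order.2 ⟨fun a ha => ?_, fun a ha => hlt.mono fun x hx => hx.trans ha⟩
  -- The points of `U` with `|T| ≤ a` lie in a compact subset of `U`, hence away from `p`.
  have hsub : closedBall (0 : ℂ) a ⊆ ball 0 1 := closedBall_subset_ball ha
  have hK : IsCompact (S '' closedBall 0 a) :=
    (isCompact_closedBall _ _).image_of_continuousOn (hS.continuousOn.mono hsub)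
  have hpK : p ∉ S '' closedBall 0 a := by
    rintro ⟨y, hy, rfl⟩
    exact hpU (hSm (hsub hy))
  filter_upwards [mem_nhdsWithin_of_mem_nhds (hK.isClosed.isOpen_compl.mem_nhds hpK),
    self_mem_nhdsWithin] with x hx hxU
  by_contra h
  exact hx ⟨T x, by simpa using h, hST.1 hxU⟩

end IsBiholomorphism

/-! ### Maximum principle and uniqueness of the regular part. -/

/-- A superlevel set of a continuous function on a bounded open set is compact if the level is not
approached at the boundary. -/
lemma isCompact_superlevel {Ω : Set ℂ} (hΩ : IsOpen Ω) (hb : Bornology.IsBounded Ω) {f : ℂ → ℝ}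
    (hf : ContinuousOn f Ω) {c : ℝ} (h : ∀ p ∈ frontier Ω, ∀ᶠ x in 𝓝[Ω] p, f x < c) :
    IsCompact {x ∈ Ω | c ≤ f x} := by
  refine isCompact_of_isClosed_isBounded ?_ (hb.subset fun x hx => hx.1)
  refine isClosed_of_closure_subset fun p hp => ?_
  have hpΩ : p ∈ closure Ω := closure_mono (fun x hx => hx.1) hp
  have hfr : ∃ᶠ x in 𝓝[Ω] p, c ≤ f x := by
    rw [mem_closure_iff_frequently] at hp
    rw [frequently_nhdsWithin_iff]
    exact hp.mono fun x hx => ⟨hx.2, hx.1⟩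
  by_cases hpm : p ∈ Ω
  · refine ⟨hpm, ?_⟩
    by_contra! hlt
    exact hfr ((hf p hpm |>.eventually (gt_mem_nhds hlt)).mono fun x hx => not_le.2 hx)
  · have : p ∈ frontier Ω := by rw [hΩ.frontier_eq]; exact ⟨hpΩ, hpm⟩
    exact absurd ((h p this).mono fun x hx => not_le.2 hx) hfr

/-- Locally `u = Re F` with `F` holomorphic, and `|exp F| = exp u`, so this is the maximum modulus
principle for `exp F`. -/
lemma InnerProductSpace.HarmonicAt.eventually_eq_of_isLocalMax {u : ℂ → ℝ} {c : ℂ}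
    (hu : InnerProductSpace.HarmonicAt u c) (hc : IsLocalMax u c) : ∀ᶠ y in 𝓝 c, u y = u c := by
  obtain ⟨r, hr, hball⟩ := Metric.isOpen_iff.1
    (InnerProductSpace.isOpen_setOfPred_harmonicAt u) c hu
  obtain ⟨F, hF, hFu⟩ := InnerProductSpace.HarmonicOnNhd.exists_analyticOnNhd_ball_re_eq
    (f := u) (z := c) (R := r) fun y hy => hball hy
  have hmem := ball_mem_nhds c hr
  have hnorm : ∀ y ∈ ball c r, ‖Complex.exp (F y)‖ = Real.exp (u y) := fun y hy => by
    rw [Complex.norm_exp]; congr 1; exact hFu hy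
  have := Complex.norm_eventually_eq_of_isLocalMax (f := fun y => Complex.exp (F y)) (c := c)
    (Filter.eventually_of_mem hmem fun y hy => (hF y hy).differentiableAt.cexp) (by
      filter_upwards [hc, hmem] with y hy hyb
      simp only [Function.comp, hnorm y hyb, hnorm c (mem_ball_self hr)]
      exact Real.exp_le_exp.2 hy)
  filter_upwards [this, hmem] with y hy hyb
  rw [hnorm y hyb, hnorm c (mem_ball_self hr)] at hy
  exact Real.exp_injective hy

/-- **Maximum principle**: a harmonic function on a bounded domain with zero boundary values is
nonpositive. -/
lemma InnerProductSpace.HarmonicOnNhd.nonpos_of_tendsto_frontier {Ω : Set ℂ} (hΩ : IsOpen Ω)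
    (hb : Bornology.IsBounded Ω) (hc : IsPreconnected Ω) {u : ℂ → ℝ}
    (hu : InnerProductSpace.HarmonicOnNhd u Ω)
    (h : ∀ p ∈ frontier Ω, Tendsto u (𝓝[Ω] p) (𝓝 0)) {a : ℂ} (ha : a ∈ Ω) : u a ≤ 0 := by
  by_contra! hpos
  have hcont : ContinuousOn u Ω := fun x hx => (hu x hx).1.continuousAt.continuousWithinAt
  have hK : IsCompact {x ∈ Ω | u a ≤ u x} :=
    isCompact_superlevel hΩ hb hcont fun p hp => (h p hp).eventually (gt_mem_nhds hpos)
  obtain ⟨b, hbK, hmax⟩ := hK.exists_isMaxOn ⟨a, ha, le_rfl⟩ (hcont.mono fun x hx => hx.1)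
  have hmaxΩ : ∀ x ∈ Ω, u x ≤ u b := fun x hx => by
    by_cases hxa : u a ≤ u x
    · exact hmax ⟨hx, hxa⟩
    · exact (not_le.1 hxa).le.trans hbK.2
  have hloc : IsLocalMax u b := Filter.eventually_of_mem (hΩ.mem_nhds hbK.1) hmaxΩ
  -- By the identity theorem `u` is a positive constant, contrary to its zero boundary values.
  have hconst : EqOn u (fun _ => u b) Ω :=
    AnalyticOnNhd.eqOn_of_preconnected_of_eventuallyEq (𝕜 := ℝ)
      (fun x hx => HarmonicAt.analyticAt (hu x hx)) (fun x _ => analyticAt_const) hc hbK.1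
      ((hu b hbK.1).eventually_eq_of_isLocalMax hloc)
  have hne : (frontier Ω).Nonempty := by
    rw [nonempty_frontier_iff]
    refine ⟨⟨a, ha⟩, fun huniv => ?_⟩
    rw [huniv] at hb
    exact NormedSpace.unbounded_univ ℝ ℂ hb
  obtain ⟨p, hp⟩ := hne
  have : (𝓝[Ω] p).NeBot := mem_closure_iff_nhdsWithin_neBot.1 (frontier_subset_closure hp)
  have ht : Tendsto u (𝓝[Ω] p) (𝓝 (u b)) :=
    tendsto_const_nhds.congr' (Filter.eventually_of_mem self_mem_nhdsWithin fun x hx =>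
      (hconst hx).symm)
  have := tendsto_nhds_unique ht (h p hp)
  linarith [hbK.2]

lemma IsGreenRegularPart.eqOn {Ω : Set ℂ} (hΩ : IsOpen Ω) (hb : Bornology.IsBounded Ω)
    (hc : IsPreconnected Ω) {y : ℂ} {f g : ℂ → ℝ} (hf : IsGreenRegularPart Ω y f)
    (hg : IsGreenRegularPart Ω y g) : EqOn f g Ω := by
  have key : ∀ {f g : ℂ → ℝ}, IsGreenRegularPart Ω y f → IsGreenRegularPart Ω y g →
      ∀ x ∈ Ω, f x - g x ≤ 0 := fun {f g} hf hg x hx => by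
    refine InnerProductSpace.HarmonicOnNhd.nonpos_of_tendsto_frontier hΩ hb hc
      (u := f - g) (hf.harmonic.sub hg.harmonic) (fun p hp => ?_) hx
    simpa using ((hf.boundary p hp).sub (hg.boundary p hp)).congr fun x => by
      simp
  intro x hx
  linarith [key hf hg x hx, key hg hf x hx]

/-! ### The Green and Robin functions in terms of the Riemann map. -/

namespace IsBiholomorphism

variable {T : ℂ → ℂ} {Ω : Set ℂ}

lemma one_sub_conj_mul_ne_zero {a w : ℂ} (ha : ‖a‖ < 1) (hw : ‖w‖ < 1) : 1 - conj a * w ≠ 0 := by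
  intro h
  have h1 : conj a * w = 1 := (sub_eq_zero.1 h).symm
  have h2 : ‖a‖ * ‖w‖ = 1 := by simpa using congrArg norm h1
  nlinarith [norm_nonneg a, norm_nonneg w]

/-- Divided by the left side, this measures how far the Möbius factor `(w - a)/(1 - conj a * w)` is
from modulus one. -/
lemma norm_one_sub_conj_mul_sq (a w : ℂ) :
    ‖1 - conj a * w‖ ^ 2 = ‖w - a‖ ^ 2 + (1 - ‖a‖ ^ 2) * (1 - ‖w‖ ^ 2) := by
  simp only [← Complex.normSq_eq_norm_sq, Complex.normSq_apply]
  simp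
  ring

/-- The regular part of the Green's function in terms of a Riemann map. -/
lemma isGreenRegularPart (hT : IsBiholomorphism T Ω (ball 0 1)) (hΩ : IsOpen Ω) {y : ℂ}
    (hy : y ∈ Ω) : IsGreenRegularPart Ω y
      fun x => (2 * Real.pi)⁻¹ * Real.log ‖dslope T y x / (1 - conj (T y) * T x)‖ := by
  have hTy := hT.norm_lt_one hy
  have hden : ∀ x ∈ Ω, 1 - conj (T y) * T x ≠ 0 := fun x hx =>
    one_sub_conj_mul_ne_zero hTy (hT.norm_lt_one hx)
  constructor
  · intro x hx
    have hd : AnalyticAt ℂ (dslope T y) x :=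
      ((Complex.differentiableOn_dslope (hΩ.mem_nhds hy)).2 hT.1).analyticAt (hΩ.mem_nhds hx)
    have hne : dslope T y x ≠ 0 := by
      rcases eq_or_ne x y with rfl | hxy
      · rw [dslope_same]; exact hT.deriv_ne_zero hΩ isOpen_ball hx
      · have h1 := sub_smul_dslope T y x
        intro h0
        rw [h0, smul_zero] at h1
        exact hxy (hT.injOn hx hy (sub_eq_zero.1 h1.symm))
    have hTx := hT.analyticAt hΩ hx
    exact InnerProductSpace.HarmonicAt.const_smul (c := (2 * Real.pi)⁻¹)
      ((hd.div (analyticAt_const.sub (analyticAt_const.mul hTx)) (hden x hx)).harmonicAt_log_norm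
        (div_ne_zero hne (hden x hx)))
  · intro p hp
    have hpy : p ≠ y := fun h => (hΩ.frontier_eq ▸ hp).2 (h ▸ hy)
    have hn := hT.tendsto_norm hΩ hp
    set k : ℝ := 1 - ‖T y‖ ^ 2
    have hle : ∀ x ∈ Ω, (1 - ‖T y‖) ^ 2 ≤ ‖1 - conj (T y) * T x‖ ^ 2 := fun x hx => by
      have h1 : ‖conj (T y) * T x‖ ≤ ‖T y‖ := by
        rw [norm_mul, Complex.norm_conj]
        exact mul_le_of_le_one_right (norm_nonneg _) (hT.norm_lt_one hx).le
      have h2 := norm_sub_norm_le (1 : ℂ) (conj (T y) * T x)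
      rw [norm_one] at h2
      exact pow_le_pow_left₀ (by linarith) (by linarith) 2
    -- The squared modulus of `(T x - T y)/(1 - conj (T y) * T x)` is one minus this quantity. It
    -- tends to zero because `|T| → 1` and the denominator is at least `(1 - |T y|)²`; `T` itself
    -- need not extend to the boundary.
    have hsmall : Tendsto (fun x => k * (1 - ‖T x‖ ^ 2) / ‖1 - conj (T y) * T x‖ ^ 2)
        (𝓝[Ω] p) (𝓝 0) := by
      have hup : Tendsto (fun x => k * (1 - ‖T x‖ ^ 2) / (1 - ‖T y‖) ^ 2) (𝓝[Ω] p) (𝓝 0) := by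
        simpa using ((((hn.pow 2).const_sub 1).const_mul k).div_const ((1 - ‖T y‖) ^ 2))
      have hk : 0 ≤ k := (hT.one_sub_norm_sq_pos hy).le
      refine squeeze_zero' ?_ ?_ hup
      · filter_upwards [self_mem_nhdsWithin] with x hx
        have := hT.one_sub_norm_sq_pos hx
        positivity
      · filter_upwards [self_mem_nhdsWithin] with x hx
        have := hT.one_sub_norm_sq_pos hx
        exact div_le_div_of_nonneg_left (by positivity) (by nlinarith) (hle x hx)
    have hlog : Tendsto (fun x => (2 * Real.pi)⁻¹ * (2⁻¹ *
        Real.log (1 - k * (1 - ‖T x‖ ^ 2) / ‖1 - conj (T y) * T x‖ ^ 2))) (𝓝[Ω] p) (𝓝 0) := by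
      have h1 := hsmall.const_sub 1
      rw [sub_zero] at h1
      simpa using ((h1.log one_ne_zero).const_mul 2⁻¹).const_mul (2 * Real.pi)⁻¹
    refine hlog.congr' ?_
    filter_upwards [self_mem_nhdsWithin,
      mem_nhdsWithin_of_mem_nhds (isOpen_ne.mem_nhds hpy)] with x hx hxy
    have hTxy : T x - T y ≠ 0 := fun h => hxy (hT.injOn hx hy (sub_eq_zero.1 h))
    have hsub := sub_smul_dslope T y x
    have hd : dslope T y x ≠ 0 := fun h0 => hTxy (by rw [← hsub, h0, smul_zero])
    rw [← mul_add, ← Real.log_mul (norm_ne_zero_iff.2 (sub_ne_zero.2 hxy))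
      (norm_ne_zero_iff.2 (div_ne_zero hd (hden x hx))), ← norm_mul, ← mul_div_assoc,
      ← smul_eq_mul (x - y), hsub, norm_div]
    congr 1
    have hpos : 0 < ‖1 - conj (T y) * T x‖ ^ 2 := by
      have := norm_pos_iff.2 (hden x hx); positivity
    have : 1 - k * (1 - ‖T x‖ ^ 2) / ‖1 - conj (T y) * T x‖ ^ 2 =
        (‖T x - T y‖ / ‖1 - conj (T y) * T x‖) ^ 2 := by
      rw [div_pow, eq_div_iff hpos.ne', sub_mul, div_mul_cancel₀ _ hpos.ne', one_mul]
      linarith [norm_one_sub_conj_mul_sq (T y) (T x)]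
    rw [this, Real.log_pow]
    push_cast
    ring

lemma robinFunction_eq (hT : IsBiholomorphism T Ω (ball 0 1)) (hΩ : IsOpen Ω)
    (hb : Bornology.IsBounded Ω) {x : ℂ} (hx : x ∈ Ω) :
    robinFunction Ω x = (2 * Real.pi)⁻¹ * (Real.log ‖deriv T x‖ - Real.log (1 - ‖T x‖ ^ 2)) := by
  have hG := hT.isGreenRegularPart hΩ hx
  have hex : ∃ f : ℂ → ℝ, IsGreenRegularPart Ω x f := ⟨_, hG⟩
  rw [robinFunction, greenRegularPart, dif_pos hex,
    hex.choose_spec.eqOn hΩ hb hT.isPreconnected_of_ball hG hx]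
  have hpos := hT.one_sub_norm_sq_pos hx
  have h1 : 1 - conj (T x) * T x = ((1 - ‖T x‖ ^ 2 : ℝ) : ℂ) := by
    rw [Complex.conj_mul']; push_cast; ring
  simp only [dslope_same]
  rw [h1, norm_div, Complex.norm_real, Real.norm_of_nonneg hpos.le,
    Real.log_div (norm_ne_zero_iff.2 (hT.deriv_ne_zero hΩ isOpen_ball hx)) hpos.ne']

end IsBiholomorphism

/-! ### The gradient of the Robin function, with vectors written as complex numbers. -/

lemma HasDerivAt.hasGradientAt_norm_sq {f : ℂ → ℂ} {f' x : ℂ} (hf : HasDerivAt f f' x) :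
    HasGradientAt (fun y => ‖f y‖ ^ 2) (2 * f x * conj f') x := by
  rw [hasGradientAt_iff_hasFDerivAt]
  have h := (hf.hasFDerivAt.restrictScalars ℝ).norm_sq
  refine h.congr_fderiv ?_
  ext w
  simp [Complex.inner]
  ring

lemma HasGradientAt.scomp {g : ℂ → ℝ} {g' x : ℂ} {φ : ℝ → ℝ} {φ' : ℝ}
    (hφ : HasDerivAt φ φ' (g x)) (hg : HasGradientAt g g' x) :
    HasGradientAt (fun y => φ (g y)) (φ' * g') x := by
  rw [hasGradientAt_iff_hasFDerivAt] at *
  refine (hφ.comp_hasFDerivAt x hg).congr_fderiv ?_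
  ext w
  simp [Complex.inner]
  ring

/-- The gradient of the Robin function in terms of a Riemann map `T`. -/
noncomputable def robinGradient (T : ℂ → ℂ) (x : ℂ) : ℂ :=
  (2 * Real.pi : ℂ)⁻¹ * (conj (deriv (deriv T) x / deriv T x) +
    2 * T x * conj (deriv T x) / (1 - T x * conj (T x)))

namespace IsBiholomorphism

variable {T : ℂ → ℂ} {Ω : Set ℂ}

lemma hasGradientAt_robinFunction (hT : IsBiholomorphism T Ω (ball 0 1)) (hΩ : IsOpen Ω)
    (hb : Bornology.IsBounded Ω) {x : ℂ} (hx : x ∈ Ω) :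
    HasGradientAt (robinFunction Ω) (robinGradient T x) x := by
  have hTx := hT.analyticAt hΩ hx
  have hne := hT.deriv_ne_zero hΩ isOpen_ball hx
  have hpos := hT.one_sub_norm_sq_pos hx
  have hpos' : (0 : ℝ) < ‖deriv T x‖ ^ 2 := by have := norm_pos_iff.2 hne; positivity
  have h1 := hTx.differentiableAt.hasDerivAt.hasGradientAt_norm_sq
  have h2 := hTx.deriv.differentiableAt.hasDerivAt.hasGradientAt_norm_sq
  -- `ln|T'|` is treated as half the logarithm of `|T'|²`, to which the gradient formula for squared
  -- norms applies.
  have h3 := HasGradientAt.scomp (φ := fun s => 2⁻¹ * Real.log s)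
    ((Real.hasDerivAt_log hpos'.ne').const_mul 2⁻¹) h2
  have h4 := HasGradientAt.scomp (φ := fun s => Real.log (1 - s))
    (((hasDerivAt_id _).const_sub 1).log hpos.ne') h1
  rw [hasGradientAt_iff_hasFDerivAt] at h3 h4 ⊢
  have h5 := (h3.sub h4).const_mul (2 * Real.pi)⁻¹
  refine (h5.congr_of_eventuallyEq ?_).congr_fderiv ?_
  · filter_upwards [hΩ.mem_nhds hx] with y hy
    rw [hT.robinFunction_eq hΩ hb hy]
    simp
  · rw [← map_sub, ← map_smul]
    congr 1
    have e1 : (1 - T x * conj (T x)) = ((1 - ‖T x‖ ^ 2 : ℝ) : ℂ) := by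
      rw [Complex.mul_conj']; push_cast; ring
    have e2 : conj (deriv T x) * deriv T x = ((‖deriv T x‖ ^ 2 : ℝ) : ℂ) := by
      rw [Complex.conj_mul']; push_cast; ring
    have hc1 : ((1 - ‖T x‖ ^ 2 : ℝ) : ℂ) ≠ 0 := by exact_mod_cast hpos.ne'
    have hc2 : ((‖deriv T x‖ ^ 2 : ℝ) : ℂ) ≠ 0 := by exact_mod_cast hpos'.ne'
    have hc3 : conj (deriv T x) ≠ 0 := by simpa using hne
    rw [robinGradient, e1, map_div₀, Complex.real_smul, Complex.ofReal_inv, Complex.ofReal_mul,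
      Complex.ofReal_ofNat, Complex.ofReal_mul, Complex.ofReal_inv, Complex.ofReal_ofNat,
      Complex.ofReal_inv, ← e2, Complex.ofReal_div]
    congr 1
    field_simp
    push_cast
    ring

lemma vortexVelocity_eq (hT : IsBiholomorphism T Ω (ball 0 1)) (hΩ : IsOpen Ω)
    (hb : Bornology.IsBounded Ω) {x : ℂ} (hx : x ∈ Ω) :
    vortexVelocity Ω x = (1 / 2 : ℂ) * (Complex.I * robinGradient T x) := by
  rw [vortexVelocity, (hT.hasGradientAt_robinFunction hΩ hb hx).gradient]

lemma contDiffAt_robinGradient (hT : IsBiholomorphism T Ω (ball 0 1)) (hΩ : IsOpen Ω)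
    {x : ℂ} (hx : x ∈ Ω) : ContDiffAt ℝ 1 (robinGradient T) x := by
  have hTx := hT.analyticAt hΩ hx
  have c0 : ContDiffAt ℝ 1 T x := hTx.contDiffAt.restrict_scalars ℝ
  have c1 : ContDiffAt ℝ 1 (deriv T) x := hTx.deriv.contDiffAt.restrict_scalars ℝ
  have c2 : ContDiffAt ℝ 1 (deriv (deriv T)) x := hTx.deriv.deriv.contDiffAt.restrict_scalars ℝ
  have hconj : ∀ {f : ℂ → ℂ}, ContDiffAt ℝ 1 f x → ContDiffAt ℝ 1 (fun y => conj (f y)) x :=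
    fun hf => Complex.conjCLE.contDiff.contDiffAt.comp x hf
  have hne := hT.deriv_ne_zero hΩ isOpen_ball hx
  refine contDiffAt_const.mul ((hconj (c2.mul (c1.inv hne))).add
    (((contDiffAt_const.mul c0).mul (hconj c1)).mul
      ((contDiffAt_const.sub (c0.mul (hconj c0))).inv ?_)))
  rw [mul_comm]
  exact one_sub_conj_mul_ne_zero (hT.norm_lt_one hx) (hT.norm_lt_one hx)

end IsBiholomorphism

/-! ### Blow-up of the Robin function at the boundary. -/

/-- A quantitative covering theorem: a bounded holomorphic function on the unit disk whose
derivative at the origin is bounded below covers a disk of definite size. -/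
lemma exists_ball_subset_image_of_le_norm_deriv {M d : ℝ} (hM : 0 ≤ M) (hd : 0 < d) :
    ∃ c > 0, ∀ f : ℂ → ℂ, DifferentiableOn ℂ f (ball 0 1) →
      MapsTo f (ball 0 1) (closedBall (f 0) M) → d ≤ ‖deriv f 0‖ →
      ball (f 0) c ⊆ f '' ball 0 1 := by
  -- `2M` bounds the oscillation of `dslope f 0` about its value at `0`; the extra `d` makes `K`
  -- positive and `ρ < 1`. The Schwarz lemma then keeps `|dslope f 0| ≥ d/2` on `|ζ| = ρ`.
  set K : ℝ := 2 * M + d with hK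
  have hKpos : 0 < K := by positivity
  set ρ : ℝ := d / (2 * K) with hρ
  have hρpos : 0 < ρ := by positivity
  have hρ1 : ρ < 1 := by rw [hρ, div_lt_one (by positivity)]; linarith
  have hKρ : K * ρ = d / 2 := by rw [hρ]; field_simp
  refine ⟨ρ * (d / 2) / 2, by positivity, fun f hf hm hdf => ?_⟩
  have hsub : closedBall (0 : ℂ) ρ ⊆ ball 0 1 := closedBall_subset_ball hρ1
  have h0 : (0 : ℂ) ∈ ball (0 : ℂ) 1 := mem_ball_self one_pos
  have hg : DifferentiableOn ℂ (dslope f 0) (ball 0 1) :=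
    (Complex.differentiableOn_dslope (isOpen_ball.mem_nhds h0)).2 hf
  have hgM : ∀ ζ ∈ ball (0 : ℂ) 1, ‖dslope f 0 ζ‖ ≤ M := fun ζ hζ => by
    simpa using Complex.norm_dslope_le_div_of_mapsTo_ball hf hm hζ
  have hgm : MapsTo (dslope f 0) (ball 0 1) (closedBall (dslope f 0 0) K) := fun ζ hζ => by
    rw [mem_closedBall, dist_eq_norm]
    linarith [norm_sub_le (dslope f 0 ζ) (dslope f 0 0), hgM ζ hζ, hgM 0 h0]
  have hlow : ∀ ζ ∈ sphere (0 : ℂ) ρ, ρ * (d / 2) ≤ ‖f ζ - f 0‖ := fun ζ hζ => by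
    have hζρ : ‖ζ‖ = ρ := by simpa using hζ
    have h1 := Complex.dist_le_div_mul_dist_of_mapsTo_ball hg hgm (hsub (sphere_subset_closedBall hζ))
    rw [div_one, dist_zero_right, hζρ, hKρ, dslope_same, dist_comm, dist_eq_norm] at h1
    have h2 := norm_sub_norm_le (deriv f 0) (dslope f 0 ζ)
    rw [← sub_smul_dslope, sub_zero, norm_smul, hζρ]
    exact mul_le_mul_of_nonneg_left (by linarith) hρpos.le
  have hne : ∃ᶠ z in 𝓝 (0 : ℂ), f z ≠ f 0 := by
    have hdz : deriv f 0 ≠ 0 := norm_pos_iff.1 (hd.trans_le hdf)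
    have := (hf.differentiableAt (isOpen_ball.mem_nhds h0)).hasDerivAt.eventually_ne (c := f 0) hdz
    exact this.frequently.filter_mono nhdsWithin_le_nhds
  have hdiff : DiffContOnCl ℂ f (ball 0 ρ) := by
    apply DifferentiableOn.diffContOnCl
    rw [closure_ball _ hρpos.ne']
    exact hf.mono hsub
  exact (hdiff.ball_subset_image_closedBall hρpos hlow hne).trans (image_mono hsub)

namespace IsBiholomorphism

variable {T : ℂ → ℂ} {Ω : Set ℂ}

/-- The conformal radius tends to zero at the boundary. -/
lemma eventually_conformalRadius_lt (hT : IsBiholomorphism T Ω (ball 0 1)) (hΩ : IsOpen Ω)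
    (hb : Bornology.IsBounded Ω) {p : ℂ} (hp : p ∈ frontier Ω) {δ : ℝ} (hδ : 0 < δ) :
    ∀ᶠ x in 𝓝[Ω] p, (1 - ‖T x‖ ^ 2) / ‖deriv T x‖ < δ := by
  have hpΩ : p ∉ Ω := fun h => (hΩ.frontier_eq ▸ hp).2 h
  obtain ⟨c, hc, hcov⟩ := exists_ball_subset_image_of_le_norm_deriv
    (M := diam Ω) (d := δ / 2) diam_nonneg (by positivity)
  filter_upwards [mem_nhdsWithin_of_mem_nhds (ball_mem_nhds p hc), self_mem_nhdsWithin]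
    with x hxp hx
  by_contra! hle
  have hlt := hT.norm_lt_one hx
  have hne := hT.deriv_ne_zero hΩ isOpen_ball hx
  have hTx := (hT.analyticAt hΩ hx).differentiableAt.hasDerivAt
  obtain ⟨-, hTm, S, hS, hSm, hST⟩ := hT
  have hSx := (hS.differentiableAt (isOpen_ball.mem_nhds (hTm hx))).hasDerivAt
  have hmul : deriv S (T x) * deriv T x = 1 :=
    ((hSx.comp x hTx).congr_of_eventuallyEq (f₁ := id)
      (Filter.eventually_of_mem (hΩ.mem_nhds hx) fun y hy => (hST.1 hy).symm)).unique
      (hasDerivAt_id x)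
  set k : ℝ := 1 - ‖T x‖ with hk
  have hkpos : 0 < k := by linarith
  -- `S ∘ A` maps the unit disk into `Ω`, sends `0` to `x` and has derivative of modulus `(1 - |T
  -- x|)/|T' x| ≥ δ/2` there, as `1 - |T x|² ≤ 2(1 - |T x|)`. Its image would thus cover a disk
  -- about `x` of radius `c`, independent of `x`, and so contain `p`.
  set A : ℂ → ℂ := fun ζ => T x + k * ζ with hA
  have hAm : MapsTo A (ball 0 1) (ball 0 1) := fun ζ hζ => by
    have hζ1 : ‖ζ‖ < 1 := by simpa using hζ
    rw [mem_ball_zero_iff]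
    calc ‖A ζ‖ ≤ ‖T x‖ + ‖(k : ℂ) * ζ‖ := norm_add_le _ _
      _ = ‖T x‖ + k * ‖ζ‖ := by rw [norm_mul, Complex.norm_real, Real.norm_of_nonneg hkpos.le]
      _ < 1 := by nlinarith
  have hAd : ∀ ζ, HasDerivAt A k ζ := fun ζ => by
    simpa [hA] using (((hasDerivAt_id' ζ).const_mul (k : ℂ)).const_add (T x))
  have hA0 : A 0 = T x := by simp [hA]
  have hf0 : (S ∘ A) 0 = x := by simp [hA0, hST.1 hx]
  have hfd : HasDerivAt (S ∘ A) (deriv S (T x) * k) 0 := by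
    refine HasDerivAt.comp 0 ?_ (hAd 0)
    rwa [hA0]
  have hball := hcov (S ∘ A)
    (hS.comp (fun ζ _ => (hAd ζ).differentiableAt.differentiableWithinAt) hAm)
    (fun ζ hζ => by
      rw [mem_closedBall, hf0]
      exact dist_le_diam_of_mem hb (hSm (hAm hζ)) hx)
    (by
      have hS1 : ‖deriv S (T x)‖ = 1 / ‖deriv T x‖ := by
        rw [eq_div_iff (norm_ne_zero_iff.2 hne), ← norm_mul, hmul, norm_one]
      have hTpos := norm_pos_iff.2 hne
      rw [hfd.deriv, norm_mul, Complex.norm_real, Real.norm_of_nonneg hkpos.le, hS1,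
        one_div_mul_eq_div, le_div_iff₀ hTpos]
      rw [le_div_iff₀ hTpos] at hle
      nlinarith [norm_nonneg (T x)])
  rw [hf0] at hball
  obtain ⟨ζ, hζ, hζp⟩ := hball (show p ∈ ball x c by rwa [mem_ball_comm])
  exact hpΩ (hζp ▸ hSm (hAm hζ))

lemma continuousOn_robinFunction (hT : IsBiholomorphism T Ω (ball 0 1)) (hΩ : IsOpen Ω)
    (hb : Bornology.IsBounded Ω) : ContinuousOn (robinFunction Ω) Ω := fun _ hx =>
  (hT.hasGradientAt_robinFunction hΩ hb hx).continuousAt.continuousWithinAt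

/-- `-2π` times the Robin function is the logarithm of the conformal radius, which tends to `-∞` at
the boundary. -/
lemma isCompact_sublevel_robinFunction (hT : IsBiholomorphism T Ω (ball 0 1)) (hΩ : IsOpen Ω)
    (hb : Bornology.IsBounded Ω) (E : ℝ) : IsCompact {x ∈ Ω | robinFunction Ω x ≤ E} := by
  have h := isCompact_superlevel hΩ hb (hT.continuousOn_robinFunction hΩ hb).neg (c := -E) ?_
  · simpa using h
  intro p hp
  filter_upwards [hT.eventually_conformalRadius_lt hΩ hb hp
    (Real.exp_pos (2 * Real.pi * -E)), self_mem_nhdsWithin] with x hx hxΩ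
  have hpos := hT.one_sub_norm_sq_pos hxΩ
  have hne := norm_pos_iff.2 (hT.deriv_ne_zero hΩ isOpen_ball hxΩ)
  have h1 := (Real.log_lt_iff_lt_exp (div_pos hpos hne)).2 hx
  rw [Real.log_div hpos.ne' hne.ne'] at h1
  rw [Pi.neg_apply, hT.robinFunction_eq hΩ hb hxΩ]
  have : (2 * Real.pi)⁻¹ * (Real.log (1 - ‖T x‖ ^ 2) - Real.log ‖deriv T x‖) < -E := by
    rw [inv_mul_lt_iff₀ (by positivity)]
    linarith
  linarith

end IsBiholomorphism

/-! ### Global existence of trajectories. -/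

/-- A bounded Lipschitz vector field has forward-global integral curves. -/
lemma exists_isIntegralCurveOn_Ici {E : Type*} [NormedAddCommGroup E] [NormedSpace ℝ E]
    [CompleteSpace E] {v : E → E} {K L : NNReal} (hv : LipschitzWith K v) (hL : ∀ x, ‖v x‖ ≤ L)
    (x : E) : ∃ z : ℝ → E, z 0 = x ∧ IsIntegralCurveOn z (fun _ => v) (Ici 0) := by
  have hloc : ∀ n : ℕ, ∃ α : ℝ → E, α 0 = x ∧
      ∀ t ∈ Icc (0 : ℝ) (n + 1), HasDerivWithinAt α (v (α t)) (Icc 0 (n + 1)) t := fun n => by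
    have h0 : (0 : ℝ) ∈ Icc (0 : ℝ) (n + 1) := ⟨le_rfl, by positivity⟩
    -- The bound `L` holds everywhere, so the ball of radius `L * (n + 1)` suffices for the whole
    -- time interval.
    have hPL : IsPicardLindelof (fun _ => v) (⟨0, h0⟩ : Icc (0 : ℝ) (n + 1)) x
        (L * (n + 1)) 0 L K := by
      refine IsPicardLindelof.of_time_independent (fun y _ => hL y) hv.lipschitzOnWith ?_
      have : (0 : ℝ) ≤ n + 1 := by positivity
      simp [this]
    exact hPL.exists_eq_forall_mem_Icc_hasDerivWithinAt₀
  choose α hα0 hα using hloc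
  have hcont : ∀ n, ContinuousOn (α n) (Icc 0 (n + 1)) := fun n t ht =>
    (hα n t ht).continuousWithinAt
  have hright : ∀ m n : ℕ, m ≤ n → ∀ t ∈ Ico (0 : ℝ) (m + 1),
      HasDerivWithinAt (α n) (v (α n t)) (Ici t) t := fun m n hmn t ht => by
    have hm : (m : ℝ) ≤ n := by exact_mod_cast hmn
    refine (hα n t ⟨ht.1, by linarith [ht.2]⟩).mono_of_mem_nhdsWithin ?_
    exact mem_of_superset (Icc_mem_nhdsGE (show t < n + 1 by linarith [ht.2]))
      (Icc_subset_Icc_left ht.1)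
  have hagree : ∀ m n : ℕ, m ≤ n → EqOn (α m) (α n) (Icc 0 (m + 1)) := fun m n hmn => by
    have hm : (m : ℝ) ≤ n := by exact_mod_cast hmn
    exact ODE_solution_unique (v := fun _ => v) (fun _ => hv) (hcont m) (hright m m le_rfl)
      ((hcont n).mono (Icc_subset_Icc_right (by linarith))) (hright m n hmn) (by rw [hα0, hα0])
  -- Since `t < ⌊t⌋₊ + 1`, the piece used at `t` is still a solution slightly beyond `t`.
  refine ⟨fun t => α ⌊t⌋₊ t, by simp [hα0], fun t ht => ?_⟩
  have ht0 : 0 ≤ t := ht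
  set n := ⌊t⌋₊ with hn
  have htn : t < n + 1 := Nat.lt_floor_add_one t
  have heq : ∀ s ∈ Ico (0 : ℝ) (n + 1), α ⌊s⌋₊ s = α n s := fun s hs => by
    have hle : ⌊s⌋₊ ≤ n := by
      rw [← Nat.lt_add_one_iff, Nat.floor_lt hs.1]
      exact_mod_cast hs.2
    exact hagree _ _ hle ⟨hs.1, (Nat.lt_floor_add_one s).le⟩
  have hnhds : Ico (0 : ℝ) (n + 1) ∈ 𝓝[Ici 0] t :=
    mem_of_superset (inter_mem_nhdsWithin _ (Iio_mem_nhds htn)) fun s hs => ⟨hs.1, hs.2⟩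
  have h1 : HasDerivWithinAt (α n) (v (α n t)) (Ici 0) t :=
    (hα n t ⟨ht0, htn.le⟩).mono_of_mem_nhdsWithin (mem_of_superset hnhds Ico_subset_Icc_self)
  exact h1.congr_of_eventuallyEq (Filter.eventually_of_mem hnhds heq) rfl

/-- A `C¹` function of real variables near a compact set agrees on that set with a bounded
Lipschitz function that is a multiple of it. -/
lemma exists_lipschitz_cutoff {K Ω : Set ℂ} (hK : IsCompact K) (hΩ : IsOpen Ω) (hKΩ : K ⊆ Ω)
    {v : ℂ → ℂ} (hv : ∀ x ∈ Ω, ContDiffAt ℝ 1 v x) :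
    ∃ χ : ℂ → ℝ, (∀ x ∈ K, χ x = 1) ∧ (∃ C, LipschitzWith C fun x => (χ x : ℂ) * v x) ∧
      ∃ L : NNReal, ∀ x, ‖(χ x : ℂ) * v x‖ ≤ L := by
  obtain ⟨L, hL, hKL, hLΩ⟩ := exists_compact_between hK hΩ hKΩ
  obtain ⟨χ, hχ0, hχ1, -⟩ := exists_contMDiffMap_zero_one_of_isClosed (modelWithCornersSelf ℝ ℂ)
    (n := 1) isOpen_interior.isClosed_compl hK.isClosed
    (disjoint_left.2 fun x hx hxK => hx (hKL hxK))
  have hsupp : ∀ x, x ∉ L → (χ x : ℂ) * v x = 0 := fun x hx => by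
    have : χ x = 0 := hχ0 fun h => hx (interior_subset h)
    simp [this]
  have hcs : HasCompactSupport fun x => (χ x : ℂ) * v x := HasCompactSupport.intro hL hsupp
  have hsm : ContDiff ℝ 1 fun x => (χ x : ℂ) * v x := by
    rw [contDiff_iff_contDiffAt]
    intro x
    by_cases hx : x ∈ L
    · exact (Complex.ofRealCLM.contDiff.contDiffAt.comp x
        (contMDiff_iff_contDiff.1 χ.contMDiff).contDiffAt).mul (hv x (hLΩ hx))
    · refine (contDiffAt_const (c := (0 : ℂ))).congr_of_eventuallyEq ?_
      filter_upwards [hL.isClosed.isOpen_compl.mem_nhds hx] with y hy using hsupp y hy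
  refine ⟨χ, fun x hx => hχ1 hx, hsm.lipschitzWith_of_hasCompactSupport hcs one_ne_zero, ?_⟩
  obtain ⟨C, hC⟩ := hcs.exists_bound_of_continuous hsm.continuous
  exact ⟨C.toNNReal, fun x => (hC x).trans (Real.le_coe_toNNReal C)⟩

namespace IsBiholomorphism

variable {T : ℂ → ℂ} {Ω : Set ℂ}

lemma hasDerivWithinAt_trajectory (hT : IsBiholomorphism T Ω (ball 0 1)) (hΩ : IsOpen Ω)
    (hb : Bornology.IsBounded Ω) {z : ℝ → ℂ} (hz : IsVortexTrajectory Ω z) {t : ℝ} (ht : 0 ≤ t) :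
    HasDerivWithinAt z (1 / 2 * (Complex.I * robinGradient T (z t))) (Ici 0) t := by
  rw [← hT.vortexVelocity_eq hΩ hb (hz.mapsTo ht)]
  exact hz.isIntegralCurveOn t ht

/-- The Robin function is conserved along curves whose velocity is orthogonal to its gradient. -/
lemma robinFunction_const (hT : IsBiholomorphism T Ω (ball 0 1)) (hΩ : IsOpen Ω)
    (hb : Bornology.IsBounded Ω) {z : ℝ → ℂ} {k : ℝ → ℝ} {a b : ℝ} (hab : a ≤ b)
    (hz : ∀ t ∈ Icc a b, z t ∈ Ω) (hc : ContinuousOn z (Icc a b))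
    (hd : ∀ t ∈ Ico a b,
      HasDerivWithinAt z (k t * (1 / 2 * (Complex.I * robinGradient T (z t)))) (Ici t) t) :
    robinFunction Ω (z b) = robinFunction Ω (z a) := by
  refine constant_of_has_deriv_right_zero (f := fun t => robinFunction Ω (z t))
    ((hT.continuousOn_robinFunction hΩ hb).comp hc hz) (fun t ht => ?_) b ⟨hab, le_rfl⟩
  have h := (hasGradientAt_iff_hasFDerivAt.1
    (hT.hasGradientAt_robinFunction hΩ hb (hz t ⟨ht.1, ht.2.le⟩))).comp_hasDerivWithinAt t
    (hd t ht)
  refine h.congr_deriv ?_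
  simp [Complex.inner]
  ring

lemma robinFunction_trajectory (hT : IsBiholomorphism T Ω (ball 0 1)) (hΩ : IsOpen Ω)
    (hb : Bornology.IsBounded Ω) {z : ℝ → ℂ} (hz : IsVortexTrajectory Ω z) {t : ℝ} (ht : 0 ≤ t) :
    robinFunction Ω (z t) = robinFunction Ω (z 0) := by
  refine hT.robinFunction_const hΩ hb (k := fun _ => 1) ht (fun s hs => hz.mapsTo hs.1)
    (hz.isIntegralCurveOn.continuousOn.mono fun s hs => hs.1) fun s hs => ?_
  simpa using (hT.hasDerivWithinAt_trajectory hΩ hb hz hs.1).mono (Ici_subset_Ici.2 hs.1)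

/-- Global existence of single vortex trajectories. -/
lemma exists_isVortexTrajectory (hT : IsBiholomorphism T Ω (ball 0 1)) (hΩ : IsOpen Ω)
    (hb : Bornology.IsBounded Ω) {z₀ : ℂ} (hz₀ : z₀ ∈ Ω) :
    ∃ z : ℝ → ℂ, IsVortexTrajectory Ω z ∧ z 0 = z₀ := by
  set E := robinFunction Ω z₀ with hE
  set K := {x ∈ Ω | robinFunction Ω x ≤ E} with hKdef
  have hK : IsCompact K := hT.isCompact_sublevel_robinFunction hΩ hb E
  obtain ⟨χ, hχ, ⟨C, hC⟩, L, hL⟩ := exists_lipschitz_cutoff hK hΩ (fun x hx => hx.1)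
    (v := fun x => 1 / 2 * (Complex.I * robinGradient T x)) fun x hx =>
      contDiffAt_const.mul (contDiffAt_const.mul (hT.contDiffAt_robinGradient hΩ hx))
  obtain ⟨z, hz0, hz⟩ := exists_isIntegralCurveOn_Ici hC hL z₀
  have hzc : ContinuousOn z (Ici 0) := hz.continuousOn
  -- Continuous induction: the times at which the curve is in `K` at level `E` form a closed set
  -- that can always be extended to the right.
  have hstay : ∀ b : ℝ, 0 ≤ b → z b ∈ K ∧ robinFunction Ω (z b) = E := fun b hb0 => by
    have hclosed : IsClosed ({t | z t ∈ K ∧ robinFunction Ω (z t) = E} ∩ Icc 0 b) := by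
      have h1 : IsClosed (Icc 0 b ∩ z ⁻¹' K) :=
        (hzc.mono fun t ht => ht.1).preimage_isClosed_of_isClosed isClosed_Icc hK.isClosed
      have h2 : IsClosed ((Icc 0 b ∩ z ⁻¹' K) ∩ (fun t => robinFunction Ω (z t)) ⁻¹' {E}) :=
        ((hT.continuousOn_robinFunction hΩ hb).comp (hzc.mono fun t ht => ht.1.1)
          fun t ht => ht.2.1).preimage_isClosed_of_isClosed h1 isClosed_singleton
      convert h2 using 1
      ext t
      simp only [mem_inter_iff, mem_ofPred_eq, mem_preimage, mem_singleton_iff]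
      tauto
    refine hclosed.Icc_subset_of_forall_exists_gt
      ⟨by rw [hz0]; exact ⟨hz₀, le_rfl⟩, by rw [hz0]⟩ (fun t ht y hy => ?_) ⟨hb0, le_rfl⟩
    have ht0 : 0 ≤ t := ht.2.1
    have hcw : ContinuousWithinAt z (Ici t) t := (hzc t ht0).mono (Ici_subset_Ici.2 ht0)
    obtain ⟨u, hu, hsub⟩ := mem_nhdsGE_iff_exists_Icc_subset.1
      (hcw.preimage_mem_nhdsWithin (hΩ.mem_nhds ht.1.1.1))
    have hu' : t < u := hu
    have hy' : t < y := hy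
    have hmin : t < min u y := lt_min hu' hy'
    -- The cutoff field is a real multiple of the vortex velocity, so the Robin function is
    -- conserved even where `χ ≠ 1`.
    have hR : robinFunction Ω (z (min u y)) = robinFunction Ω (z t) :=
      hT.robinFunction_const hΩ hb (k := fun t => χ (z t)) hmin.le
        (fun s hs => hsub ⟨hs.1, hs.2.trans (min_le_left _ _)⟩)
        (hzc.mono fun s hs => ht0.trans hs.1)
        fun s hs => (hz s (ht0.trans hs.1)).mono (Ici_subset_Ici.2 (ht0.trans hs.1))
    have hRE := hR.trans ht.1.2
    exact ⟨min u y, ⟨⟨hsub ⟨hmin.le, min_le_left _ _⟩, hRE.le⟩, hRE⟩, hmin, min_le_right _ _⟩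
  refine ⟨z, ⟨fun t ht => (hstay t ht).1.1, fun t ht => ?_⟩, hz0⟩
  have h := hz t ht
  have htK := (hstay t ht).1
  simp only [hχ _ htK, Complex.ofReal_one, one_mul] at h
  rwa [← hT.vortexVelocity_eq hΩ hb htK.1] at h

end IsBiholomorphism

/-! ### Expansions at the critical point. -/

namespace IsBiholomorphism

variable {T : ℂ → ℂ} {Ω : Set ℂ}

/-- The linearization of the gradient of the Robin function at a critical point mapped to `0`. -/
lemma robinGradient_expansion (hT : IsBiholomorphism T Ω (ball 0 1)) (hΩ : IsOpen Ω) {x₀ : ℂ}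
    (hx₀ : x₀ ∈ Ω) (hT0 : T x₀ = 0) (hT2 : deriv (deriv T) x₀ = 0) {δ : ℝ} (hδ : 0 < δ) :
    ∃ r > 0, ball x₀ r ⊆ Ω ∧ ∀ w : ℂ, ‖w‖ < r →
      ‖robinGradient T (x₀ + w) - (2 * Real.pi : ℂ)⁻¹ *
        (conj (deriv (deriv (deriv T)) x₀ / deriv T x₀) * conj w +
          2 * (‖deriv T x₀‖ ^ 2 : ℝ) * w)‖ ≤ δ * ‖w‖ := by
  set c := deriv (deriv (deriv T)) x₀ / deriv T x₀ with hc
  have hTx := hT.analyticAt hΩ hx₀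
  have hne := hT.deriv_ne_zero hΩ isOpen_ball hx₀
  have hG0 : robinGradient T x₀ = 0 := by simp [robinGradient, hT0, hT2]
  have d0 := hTx.differentiableAt.hasDerivAt
  have d1 := hTx.deriv.differentiableAt.hasDerivAt
  have d2 := hTx.deriv.deriv.differentiableAt.hasDerivAt
  have hq : HasDerivAt (fun x => deriv (deriv T) x / deriv T x) c x₀ := by
    refine (d2.fun_div d1 hne).congr_deriv ?_
    rw [hT2, hc]
    field_simp
    simp
  have r0 : DifferentiableAt ℝ T x₀ := hTx.differentiableAt.restrictScalars ℝ
  have r1 : DifferentiableAt ℝ (deriv T) x₀ := hTx.deriv.differentiableAt.restrictScalars ℝ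
  have hconj : ∀ {f : ℂ → ℂ}, DifferentiableAt ℝ f x₀ → DifferentiableAt ℝ (fun y => conj (f y)) x₀ :=
    fun hf => Complex.conjCLE.differentiableAt.comp x₀ hf
  -- This is the cofactor of `T`. As `T x₀ = 0`, only its value at `x₀` enters the derivative of the
  -- product.
  have hk : DifferentiableAt ℝ
      (fun y => 2 * (conj (deriv T y) * (1 - T y * conj (T y))⁻¹)) x₀ :=
    ((hconj r1).mul (((r0.mul (hconj r0)).const_sub 1).inv (by simp [hT0]))).const_mul 2
  have h1 : HasFDerivAt (fun x => conj (deriv (deriv T) x / deriv T x)) _ x₀ :=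
    Complex.conjCLE.hasFDerivAt.comp x₀ (hq.hasFDerivAt.restrictScalars ℝ)
  have h2 := (d0.hasFDerivAt.restrictScalars ℝ).mul hk.hasFDerivAt
  have h3 := ((h1.add h2).const_mul (2 * Real.pi : ℂ)⁻¹).isLittleO
  obtain ⟨r, hr, hball⟩ := Metric.eventually_nhds_iff_ball.1
    ((h3.def hδ).and (hΩ.mem_nhds hx₀))
  refine ⟨r, hr, fun x hx => (hball x hx).2, fun w hw => ?_⟩
  have h4 := (hball (x₀ + w) (by simpa using hw)).1
  rw [add_sub_cancel_left] at h4
  refine le_trans (le_of_eq ?_) h4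
  congr 1
  have e2 : ((‖deriv T x₀‖ ^ 2 : ℝ) : ℂ) = deriv T x₀ * conj (deriv T x₀) := by
    rw [Complex.mul_conj']; push_cast; ring
  rw [e2]
  simp [robinGradient, hT0, hT2]
  ring

/-- Second order expansion of the Robin function at a critical point mapped to `0`. -/
lemma robinFunction_expansion (hT : IsBiholomorphism T Ω (ball 0 1)) (hΩ : IsOpen Ω)
    (hb : Bornology.IsBounded Ω) {x₀ : ℂ}
    (hx₀ : x₀ ∈ Ω) (hT0 : T x₀ = 0) (hT2 : deriv (deriv T) x₀ = 0) {δ : ℝ} (hδ : 0 < δ) :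
    ∃ r > 0, ∀ w : ℂ, ‖w‖ < r →
      |robinFunction Ω (x₀ + w) - robinFunction Ω x₀ - (4 * Real.pi)⁻¹ *
        ((deriv (deriv (deriv T)) x₀ / deriv T x₀ * w ^ 2).re +
          2 * ‖deriv T x₀‖ ^ 2 * ‖w‖ ^ 2)| ≤ δ * ‖w‖ ^ 2 := by
  obtain ⟨r, hr, hrΩ, hG⟩ := hT.robinGradient_expansion hΩ hx₀ hT0 hT2 hδ
  set c := deriv (deriv (deriv T)) x₀ / deriv T x₀ with hc
  set a := ‖deriv T x₀‖ ^ 2 with ha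
  refine ⟨r, hr, fun w hw => ?_⟩
  set q := (4 * Real.pi)⁻¹ * ((c * w ^ 2).re + 2 * a * ‖w‖ ^ 2) with hq
  set A : ℂ → ℂ := fun w => (2 * Real.pi : ℂ)⁻¹ * (conj c * conj w + 2 * (a : ℝ) * w) with hA
  -- Euler's identity for the quadratic form `q` with gradient `A`; it makes `t² q` the comparison
  -- function on the segment from `x₀` to `x₀ + w`.
  have hAw : inner ℝ (A w) w = 2 * q := by
    have h1 : (2 * Real.pi : ℂ)⁻¹ = (((2 * Real.pi)⁻¹ : ℝ) : ℂ) := by push_cast; rfl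
    rw [hq, hA]
    simp only [h1]
    rw [Complex.inner, ← Complex.normSq_eq_norm_sq, Complex.normSq_apply, map_mul,
      Complex.conj_ofReal, mul_left_comm, Complex.re_ofReal_mul]
    simp [pow_two]
    field_simp
    ring
  have hnorm : ∀ t ∈ Icc (0 : ℝ) 1, ‖(t : ℂ) * w‖ ≤ ‖w‖ := fun t ht => by
    rw [norm_mul, Complex.norm_real, Real.norm_of_nonneg ht.1]
    exact mul_le_of_le_one_left (norm_nonneg _) ht.2
  have hderiv : ∀ t ∈ Icc (0 : ℝ) 1, HasDerivWithinAt
      (fun t : ℝ => robinFunction Ω (x₀ + t * w) - t ^ 2 * q)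
      (inner ℝ (robinGradient T (x₀ + t * w) - A (t * w)) w) (Icc 0 1) t := fun t ht => by
    have hmem : x₀ + t * w ∈ Ω := hrΩ (by simpa using (hnorm t ht).trans_lt hw)
    have hl : HasDerivAt (fun t : ℝ => x₀ + t * w) w t := by
      simpa using ((Complex.ofRealCLM.hasDerivAt (x := t)).mul_const w).const_add x₀
    have h1 := (hasGradientAt_iff_hasFDerivAt.1
      (hT.hasGradientAt_robinFunction hΩ hb hmem)).comp_hasDerivAt t hl
    refine ((h1.sub ((hasDerivAt_pow 2 t).mul_const q)).congr_deriv ?_).hasDerivWithinAt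
    have hAt : A (t * w) = (t : ℝ) • A w := by
      simp only [hA, Complex.real_smul, map_mul, Complex.conj_ofReal]
      ring
    rw [inner_sub_left, hAt, real_inner_smul_left, hAw]
    simp [InnerProductSpace.toDual_apply_apply]
    ring
  have hbound : ∀ t ∈ Ico (0 : ℝ) 1,
      ‖inner ℝ (robinGradient T (x₀ + t * w) - A (t * w)) w‖ ≤ δ * ‖w‖ ^ 2 := fun t ht => by
    have ht' : t ∈ Icc (0 : ℝ) 1 := ⟨ht.1, ht.2.le⟩
    calc _ ≤ ‖robinGradient T (x₀ + t * w) - A (t * w)‖ * ‖w‖ := norm_inner_le_norm _ _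
      _ ≤ δ * ‖(t : ℂ) * w‖ * ‖w‖ := by gcongr; exact hG _ ((hnorm t ht').trans_lt hw)
      _ ≤ δ * ‖w‖ * ‖w‖ := by gcongr; exact hnorm t ht'
      _ = δ * ‖w‖ ^ 2 := by ring
  have h := norm_image_sub_le_of_norm_deriv_le_segment_01' hderiv hbound
  rw [Real.norm_eq_abs] at h
  refine le_trans (le_of_eq ?_) h
  congr 1
  simp
  ring

end IsBiholomorphism

/-! ### Exit times, small powers and exponential growth. -/

lemma exitTime_eq_top {z : ℝ → ℂ} {S : Set ℂ} (h : ∀ t, 0 ≤ t → z t ∈ S) : exitTime z S = ⊤ := by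
  refine ENNReal.eq_top_of_forall_nnreal_le fun r => ?_
  refine le_trans ?_ (le_iSup₂ (f := fun t (_ : t ∈ {t : ℝ | 0 ≤ t ∧ ∀ s ∈ Icc 0 t, z s ∈ S}) =>
    ENNReal.ofReal t) (r : ℝ) ⟨r.2, fun s hs => h s hs.1⟩)
  simp

lemma exists_pos_forall_of_eventually_nhdsGT {p : ℝ → Prop} (h : ∀ᶠ ε in 𝓝[>] 0, p ε) :
    ∃ ε₀ : ℝ, 0 < ε₀ ∧ ∀ ε, 0 < ε → ε ≤ ε₀ → p ε := by
  obtain ⟨u, hu, hsub⟩ := mem_nhdsGT_iff_exists_Ioc_subset.1 h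
  exact ⟨u, hu, fun ε h0 h1 => hsub ⟨h0, h1⟩⟩

lemma tendsto_rpow_nhdsGT_zero {s : ℝ} (hs : 0 < s) :
    Tendsto (fun ε : ℝ => ε ^ s) (𝓝[>] 0) (𝓝 0) := by
  have h := (Real.continuousAt_rpow_const 0 s (Or.inr hs.le)).tendsto
  rw [Real.zero_rpow hs.ne'] at h
  exact h.mono_left nhdsWithin_le_nhds

/-- Gronwall from below: `exp(-ks) V(s)` is nondecreasing. -/
lemma mul_exp_le_of_mul_le_deriv {V V' : ℝ → ℝ} {k t : ℝ} (ht : 0 ≤ t)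
    (hV : ∀ s ∈ Icc 0 t, HasDerivWithinAt V (V' s) (Ici 0) s)
    (hle : ∀ s ∈ Icc 0 t, k * V s ≤ V' s) : V 0 * Real.exp (k * t) ≤ V t := by
  have hder : ∀ s ∈ Icc 0 t, HasDerivWithinAt (fun s => Real.exp (-(k * s)) * V s)
      (Real.exp (-(k * s)) * (V' s - k * V s)) (Ici 0) s := fun s hs => by
    have h1 : HasDerivAt (fun s => Real.exp (-(k * s))) (Real.exp (-(k * s)) * -k) s := by
      simpa using (((hasDerivAt_id' s).const_mul k).neg).exp
    exact (h1.hasDerivWithinAt.mul (hV s hs)).congr_deriv (by ring)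
  have hmono : MonotoneOn (fun s => Real.exp (-(k * s)) * V s) (Icc 0 t) := by
    refine monotoneOn_of_hasDerivWithinAt_nonneg (convex_Icc 0 t)
      (f' := fun s => Real.exp (-(k * s)) * (V' s - k * V s))
      (fun s hs => (hder s hs).continuousWithinAt.mono fun x hx => hx.1) ?_ ?_
    · intro s hs
      exact (hder s (interior_subset hs)).mono fun x hx => (interior_subset hx).1
    · intro s hs
      exact mul_nonneg (Real.exp_pos _).le (sub_nonneg.2 (hle s (interior_subset hs)))
  have h := hmono ⟨le_rfl, ht⟩ ⟨ht, le_rfl⟩ ht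
  simp only [mul_zero, neg_zero, Real.exp_zero, one_mul] at h
  calc V 0 * Real.exp (k * t) ≤ Real.exp (-(k * t)) * V t * Real.exp (k * t) := by gcongr
    _ = V t * (Real.exp (-(k * t)) * Real.exp (k * t)) := by ring
    _ = V t := by rw [← Real.exp_add]; simp

/-! ### Stability at a minimum, escape from a saddle. -/

namespace IsBiholomorphism

variable {T : ℂ → ℂ} {Ω : Set ℂ}

/-- Nonlinear stability of a nondegenerate minimum of the Robin function. -/
lemma stability (hT : IsBiholomorphism T Ω (ball 0 1)) (hΩ : IsOpen Ω)
    (hb : Bornology.IsBounded Ω) {x₀ : ℂ}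
    (hx₀ : x₀ ∈ Ω) (hT0 : T x₀ = 0) (hT2 : deriv (deriv T) x₀ = 0)
    (h : ‖deriv (deriv (deriv T)) x₀ / deriv T x₀‖ < 2 * ‖deriv T x₀‖ ^ 2) :
    ∃ C > 0, ∃ r > 0, ball x₀ r ⊆ Ω ∧ ∀ ε, 0 < ε → C * ε < r → ε < r ∧
      ∀ z, IsVortexTrajectory Ω z → z 0 ∈ closedBall x₀ ε →
        ∀ t, 0 ≤ t → z t ∈ ball x₀ (C * ε) := by
  set c := deriv (deriv (deriv T)) x₀ / deriv T x₀ with hc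
  set a := ‖deriv T x₀‖ ^ 2 with ha
  have hpi := Real.pi_pos
  -- Half of the smallest coefficient of the quadratic form; the other half absorbs the error of the
  -- expansion.
  set m := (4 * Real.pi)⁻¹ * (2 * a - ‖c‖) / 2 with hm
  set M := (4 * Real.pi)⁻¹ * (2 * a + ‖c‖) + m with hM
  have hmpos : 0 < m := by
    have : 0 < 2 * a - ‖c‖ := by linarith
    positivity
  have hMpos : 0 < M := by
    have : 0 < 2 * a + ‖c‖ := by linarith [norm_nonneg c]
    positivity
  obtain ⟨r₁, hr₁, hexp⟩ := hT.robinFunction_expansion hΩ hb hx₀ hT0 hT2 hmpos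
  obtain ⟨r₂, hr₂, hr₂Ω⟩ := Metric.isOpen_iff.1 hΩ x₀ hx₀
  have hlow : ∀ w : ℂ, ‖w‖ < r₁ →
      m * ‖w‖ ^ 2 ≤ robinFunction Ω (x₀ + w) - robinFunction Ω x₀ ∧
      robinFunction Ω (x₀ + w) - robinFunction Ω x₀ ≤ M * ‖w‖ ^ 2 := fun w hw => by
    have h1 := abs_le.1 (hexp w hw)
    have h2 := abs_le.1 (Complex.abs_re_le_norm (c * w ^ 2))
    rw [norm_mul, norm_pow] at h2
    have h3 := mul_le_mul_of_nonneg_left h2.1 (show 0 ≤ (4 * Real.pi)⁻¹ by positivity)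
    have h4 := mul_le_mul_of_nonneg_left h2.2 (show 0 ≤ (4 * Real.pi)⁻¹ by positivity)
    constructor
    · have : 2 * m * ‖w‖ ^ 2 = (4 * Real.pi)⁻¹ * (-(‖c‖ * ‖w‖ ^ 2)) +
          (4 * Real.pi)⁻¹ * (2 * a * ‖w‖ ^ 2) := by rw [hm]; ring
      linarith
    · have : M * ‖w‖ ^ 2 = (4 * Real.pi)⁻¹ * (‖c‖ * ‖w‖ ^ 2) +
          (4 * Real.pi)⁻¹ * (2 * a * ‖w‖ ^ 2) + m * ‖w‖ ^ 2 := by rw [hM]; ring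
      linarith
  -- Chosen so that `M < m C²`: the Robin function on the sphere of radius `Cε` then exceeds all its
  -- values on the closed disk of radius `ε`, so no trajectory from that disk reaches the sphere.
  set C := M / m + 1 with hC
  have hC1 : 1 < C := by have := div_pos hMpos hmpos; linarith
  have hCM : M < m * C ^ 2 := by
    have h1 : M = m * (C - 1) := by rw [hC]; field_simp; ring
    nlinarith [mul_pos hmpos (show (0 : ℝ) < C by linarith)]
  refine ⟨C, by linarith, min r₁ r₂, lt_min hr₁ hr₂,
    (ball_subset_ball (min_le_right _ _)).trans hr₂Ω, fun ε hε hCε => ?_⟩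
  have hεC : ε < C * ε := by nlinarith
  refine ⟨hεC.trans hCε, fun z hz hz0 t ht => ?_⟩
  have hz0' : ‖z 0 - x₀‖ ≤ ε := by rwa [mem_closedBall, dist_eq_norm] at hz0
  by_contra hnot
  have hge : C * ε ≤ ‖z t - x₀‖ := by rwa [mem_ball, dist_eq_norm, not_lt] at hnot
  have hcont : ContinuousOn (fun s => ‖z s - x₀‖) (Icc 0 t) :=
    ((hz.isIntegralCurveOn.continuousOn.mono fun s hs => hs.1).sub continuousOn_const).norm
  obtain ⟨s, hs, hsr⟩ := intermediate_value_Icc ht hcont ⟨hz0'.trans hεC.le, hge⟩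
  simp only at hsr
  have hCr : C * ε < r₁ := hCε.trans_le (min_le_left _ _)
  have hs1 := (hlow (z s - x₀) (by rwa [hsr])).1
  have hs2 := (hlow (z 0 - x₀) (by linarith)).2
  rw [add_sub_cancel, hT.robinFunction_trajectory hΩ hb hz hs.1, hsr] at hs1
  rw [add_sub_cancel] at hs2
  have h5 : M * ‖z 0 - x₀‖ ^ 2 ≤ M * ε ^ 2 := by gcongr
  have h6 : M * ε ^ 2 < m * C ^ 2 * ε ^ 2 := by gcongr
  linarith [mul_pow C ε 2, show m * (C * ε) ^ 2 = m * C ^ 2 * ε ^ 2 by ring]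

/-- Exponential escape along the unstable direction of a saddle of the Robin function. -/
lemma instability (hT : IsBiholomorphism T Ω (ball 0 1)) (hΩ : IsOpen Ω)
    (hb : Bornology.IsBounded Ω) {x₀ : ℂ}
    (hx₀ : x₀ ∈ Ω) (hT0 : T x₀ = 0) (hT2 : deriv (deriv T) x₀ = 0)
    (h : 2 * ‖deriv T x₀‖ ^ 2 < ‖deriv (deriv (deriv T)) x₀ / deriv T x₀‖) :
    ∃ u : ℂ, ‖u‖ = 1 ∧ ∃ k > 0, ∃ r > 0, ball x₀ r ⊆ Ω ∧ ∀ (ε : ℝ) (z : ℝ → ℂ),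
      IsVortexTrajectory Ω z → z 0 = x₀ + ε * u →
        ∀ t, 0 ≤ t → (∀ s ∈ Icc 0 t, z s ∈ ball x₀ r) →
          ε ^ 2 * Real.exp (k * t) ≤ ‖z t - x₀‖ ^ 2 := by
  have hpi := Real.pi_pos
  set k := (2 * Real.pi)⁻¹ * (‖deriv (deriv (deriv T)) x₀ / deriv T x₀‖ - 2 * ‖deriv T x₀‖ ^ 2) / 2
    with hk
  have hkpos : 0 < k := by
    have := sub_pos.2 h
    positivity
  obtain ⟨r, hr, hrΩ, hG⟩ := hT.robinGradient_expansion hΩ hx₀ hT0 hT2 hkpos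
  set c := deriv (deriv (deriv T)) x₀ / deriv T x₀ with hc
  set a := ‖deriv T x₀‖ ^ 2 with ha
  have ha0 : 0 ≤ a := by positivity
  have hcpos : 0 < ‖c‖ := by linarith
  have hcne : (‖c‖ : ℂ) ≠ 0 := by exact_mod_cast hcpos.ne'
  -- This phase gives `κ * I * conj c = |c|`, so the `conj w` term of the gradient contributes
  -- `|c||w|²/(2π)` to `V'`, while the `w` term costs at most `2a|w|²/(2π)`. The difference is
  -- `2k|w|²`, of which the remainder takes `k|w|²`.
  set κ : ℂ := -Complex.I * c / ‖c‖ with hκ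
  have hκn : ‖κ‖ = 1 := by
    rw [hκ, norm_div, norm_mul, norm_neg, Complex.norm_I, Complex.norm_real, norm_norm, one_mul,
      div_self hcpos.ne']
  have hκ0 : κ ≠ 0 := norm_pos_iff.1 (by rw [hκn]; exact one_pos)
  -- With `u² = κ⁻¹`, the starting point `x₀ + εu` has `V = ε²`.
  obtain ⟨u, hu⟩ := IsAlgClosed.exists_pow_nat_eq κ⁻¹ (show 0 < 2 by norm_num)
  have hun : ‖u‖ = 1 := by
    have h1 := congrArg norm hu
    rw [norm_pow, norm_inv, hκn, inv_one] at h1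
    exact (pow_eq_one_iff_of_nonneg (norm_nonneg _) two_ne_zero).1 h1
  refine ⟨u, hun, k, hkpos, r, hr, hrΩ, fun ε z hz hz0 t ht hball => ?_⟩
  set V : ℝ → ℝ := fun s => (κ * (z s - x₀) ^ 2).re with hV
  have hVle : ∀ s, V s ≤ ‖z s - x₀‖ ^ 2 := fun s => by
    refine (Complex.re_le_norm _).trans (le_of_eq ?_)
    rw [norm_mul, hκn, one_mul, norm_pow]
  have hV0 : V 0 = ε ^ 2 := by
    simp only [hV]
    rw [hz0, add_sub_cancel_left, mul_pow, hu, mul_left_comm, mul_inv_cancel₀ hκ0, mul_one]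
    exact_mod_cast Complex.ofReal_re _
  have hVd : ∀ s ∈ Icc 0 t, HasDerivWithinAt V
      (κ * (Complex.I * ((z s - x₀) * robinGradient T (z s)))).re (Ici 0) s := fun s hs => by
    have h1 := (((hT.hasDerivWithinAt_trajectory hΩ hb hz hs.1).sub_const x₀).fun_pow 2).const_mul κ
    have h2 := Complex.reCLM.hasFDerivAt.comp_hasDerivWithinAt s h1
    refine h2.congr_deriv ?_
    rw [Complex.reCLM_apply]
    congr 1
    push_cast
    ring
  have hκc : κ * Complex.I * conj c = ‖c‖ := by
    have h1 : c * conj c = (‖c‖ : ℂ) * ‖c‖ := by rw [Complex.mul_conj']; ring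
    calc κ * Complex.I * conj c = -(Complex.I * Complex.I) * (c * conj c) / ‖c‖ := by rw [hκ]; ring
      _ = ‖c‖ := by rw [h1, Complex.I_mul_I]; field_simp
  have hVge : ∀ s ∈ Icc 0 t,
      k * V s ≤ (κ * (Complex.I * ((z s - x₀) * robinGradient T (z s)))).re := fun s hs => by
    set w := z s - x₀ with hw
    have hzw : z s = x₀ + w := by rw [hw]; ring
    have hwr : ‖w‖ < r := by have := hball s hs; rwa [mem_ball, dist_eq_norm] at this
    have herr := hG w hwr
    rw [hzw]
    set A : ℂ := (2 * Real.pi : ℂ)⁻¹ * (conj c * conj w + 2 * (a : ℝ) * w) with hA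
    set G := robinGradient T (x₀ + w)
    have hsplit : κ * (Complex.I * (w * G)) =
        κ * (Complex.I * (w * A)) + κ * (Complex.I * (w * (G - A))) := by ring
    have h1 : κ * (Complex.I * (w * A)) = (((2 * Real.pi)⁻¹ * (‖c‖ * ‖w‖ ^ 2) : ℝ) : ℂ) +
        (((2 * Real.pi)⁻¹ * (2 * a) : ℝ) : ℂ) * (κ * Complex.I * w ^ 2) := by
      push_cast
      rw [← hκc, ← Complex.mul_conj' w, hA]
      ring
    have h2 : -‖w‖ ^ 2 ≤ (κ * Complex.I * w ^ 2).re := by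
      have := (abs_le.1 (Complex.abs_re_le_norm (κ * Complex.I * w ^ 2))).1
      rwa [norm_mul, norm_mul, hκn, Complex.norm_I, norm_pow, one_mul, one_mul] at this
    have h3 : -(k * ‖w‖ ^ 2) ≤ (κ * (Complex.I * (w * (G - A)))).re := by
      have h4 := (abs_le.1 (Complex.abs_re_le_norm (κ * (Complex.I * (w * (G - A)))))).1
      rw [norm_mul, norm_mul, hκn, Complex.norm_I, norm_mul, one_mul, one_mul] at h4
      nlinarith [norm_nonneg w]
    have h5 := mul_le_mul_of_nonneg_left h2 (show 0 ≤ (2 * Real.pi)⁻¹ * (2 * a) by positivity)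
    have h6 := mul_le_mul_of_nonneg_left (hVle s) hkpos.le
    rw [hsplit, Complex.add_re, h1, Complex.add_re, Complex.ofReal_re, Complex.re_ofReal_mul]
    have h7 : 2 * k * ‖w‖ ^ 2 = (2 * Real.pi)⁻¹ * (‖c‖ * ‖w‖ ^ 2) +
        (2 * Real.pi)⁻¹ * (2 * a) * -‖w‖ ^ 2 := by rw [hk]; ring
    linarith
  have hfin := mul_exp_le_of_mul_le_deriv ht hVd hVge
  rw [hV0] at hfin
  exact hfin.trans (hVle t)

end IsBiholomorphism

/-! ### The main theorem. -/

theorem theorem4 (Ω : Set ℂ) (hΩ_open : IsOpen Ω) (hΩ_bdd : Bornology.IsBounded Ω)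
    (hΩ_sc : IsSimplyConnected Ω) (x₀ : ℂ) (hx₀ : x₀ ∈ Ω) (T : ℂ → ℂ)
    (hT : IsBiholomorphism T Ω (ball 0 1)) (hT0 : T x₀ = 0) (hT2 : iteratedDeriv 2 T x₀ = 0) :
    IsVortexTrajectory Ω (fun _ => x₀) ∧
    (‖iteratedDeriv 3 T x₀‖ < 2 * ‖deriv T x₀‖ ^ 3 →
      ∃ C : ℝ, 0 < C ∧ ∀ β : ℝ, β < 1 → ∃ ε₀ : ℝ, 0 < ε₀ ∧ ∀ ε : ℝ, 0 < ε → ε ≤ ε₀ →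
        ∀ z₀ ∈ closedBall x₀ ε,
          (∃ z : ℝ → ℂ, IsVortexTrajectory Ω z ∧ z 0 = z₀) ∧
          ∀ z : ℝ → ℂ, IsVortexTrajectory Ω z → z 0 = z₀ →
            (∀ t : ℝ, 0 ≤ t → z t ∈ ball x₀ (C * ε)) ∧
            exitTime z (ball x₀ (ε ^ β)) = ⊤) ∧
    (2 * ‖deriv T x₀‖ ^ 3 < ‖iteratedDeriv 3 T x₀‖ →
      ∃ C : ℝ, 0 < C ∧ ∀ β : ℝ, 0 < β → β < 1 → ∃ ε₀ : ℝ, 0 < ε₀ ∧ ∀ ε : ℝ, 0 < ε → ε ≤ ε₀ →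
        ∃ z₀ ∈ closedBall x₀ ε,
          (∃ z : ℝ → ℂ, IsVortexTrajectory Ω z ∧ z 0 = z₀) ∧
          ∀ z : ℝ → ℂ, IsVortexTrajectory Ω z → z 0 = z₀ →
            exitTime z (closedBall x₀ (ε ^ β)) ≤ ENNReal.ofReal (C * |Real.log ε|)) := by
  have hpos : 0 < ‖deriv T x₀‖ := norm_pos_iff.2 (hT.deriv_ne_zero hΩ_open isOpen_ball hx₀)
  have hT2' : deriv (deriv T) x₀ = 0 := by
    simpa only [iteratedDeriv_succ, iteratedDeriv_zero] using hT2
  have hT3 : iteratedDeriv 3 T x₀ = deriv (deriv (deriv T)) x₀ := by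
    simp only [iteratedDeriv_succ, iteratedDeriv_zero]
  rw [hT3]
  refine ⟨⟨fun _ _ => hx₀, fun t _ => ?_⟩, fun h => ?_, fun h => ?_⟩
  · have h0 : vortexVelocity Ω x₀ = 0 := by
      rw [hT.vortexVelocity_eq hΩ_open hΩ_bdd hx₀, robinGradient, hT0, hT2']
      simp
    simpa only [h0] using hasDerivWithinAt_const t (Ici 0) x₀
  · obtain ⟨C, hC, r, hr, hrΩ, hst⟩ := hT.stability hΩ_open hΩ_bdd hx₀ hT0 hT2' (by
      rw [norm_div, div_lt_iff₀ hpos]; linarith [pow_succ ‖deriv T x₀‖ 2])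
    refine ⟨C, hC, fun β hβ => exists_pos_forall_of_eventually_nhdsGT ?_⟩
    have h1 : Tendsto (fun ε : ℝ => C * ε) (𝓝[>] 0) (𝓝 0) := by
      have : Tendsto (fun ε : ℝ => C * ε) (𝓝 0) (𝓝 (C * 0)) := (continuous_const_mul C).tendsto 0
      rw [mul_zero] at this
      exact this.mono_left nhdsWithin_le_nhds
    have h2 : Tendsto (fun ε : ℝ => C * ε ^ (1 - β)) (𝓝[>] 0) (𝓝 0) := by
      simpa using (tendsto_rpow_nhdsGT_zero (sub_pos.2 hβ)).const_mul C
    filter_upwards [h1.eventually (gt_mem_nhds hr), h2.eventually (gt_mem_nhds one_pos),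
      self_mem_nhdsWithin] with ε hε1 hε2 hε z₀ hz₀
    have hε0 : 0 < ε := hε
    obtain ⟨hεr, hconf⟩ := hst ε hε0 hε1
    refine ⟨hT.exists_isVortexTrajectory hΩ_open hΩ_bdd
      (hrΩ (closedBall_subset_ball hεr hz₀)), fun z hz hz0 => ?_⟩
    have hin := hconf z hz (hz0 ▸ hz₀)
    refine ⟨hin, exitTime_eq_top fun t ht => ball_subset_ball ?_ (hin t ht)⟩
    have hβpos := Real.rpow_pos_of_pos hε0 β
    calc C * ε = C * ε ^ (1 - β) * ε ^ β := by
          rw [mul_assoc, ← Real.rpow_add hε0]; simp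
      _ ≤ 1 * ε ^ β := by gcongr
      _ = ε ^ β := one_mul _
  · obtain ⟨u, hu, k, hk, r, hr, hrΩ, hesc⟩ := hT.instability hΩ_open hΩ_bdd hx₀ hT0 hT2' (by
      rw [norm_div, lt_div_iff₀ hpos]; linarith [pow_succ ‖deriv T x₀‖ 2])
    -- While the vortex stays in the disk, `ε² exp(kt) ≤ ε^(2β)`, so `kt ≤ 2(1 - β)|ln ε| ≤ 2|ln
    -- ε|`; hence the constant does not depend on `β`.
    refine ⟨2 / k, by positivity, fun β hβ hβ1 => exists_pos_forall_of_eventually_nhdsGT ?_⟩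
    filter_upwards [(tendsto_rpow_nhdsGT_zero hβ).eventually (gt_mem_nhds hr),
      mem_nhdsWithin_of_mem_nhds (gt_mem_nhds one_pos), self_mem_nhdsWithin] with ε hεr hε1 hε
    have hε0 : 0 < ε := hε
    have hεβ : ε ≤ ε ^ β := by
      simpa using Real.rpow_le_rpow_of_exponent_ge hε0 hε1.le hβ1.le
    have hz₀ : x₀ + ε * u ∈ closedBall x₀ ε := by
      simp [hu, abs_of_pos hε0]
    refine ⟨x₀ + ε * u, hz₀, hT.exists_isVortexTrajectory hΩ_open hΩ_bdd
      (hrΩ (closedBall_subset_ball (hεβ.trans_lt hεr) hz₀)), fun z hz hz0 => ?_⟩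
    refine iSup₂_le fun t ht => ENNReal.ofReal_le_ofReal ?_
    have h1 := hesc ε z hz hz0 t ht.1 fun s hs => closedBall_subset_ball hεr (ht.2 s hs)
    have h2 : ‖z t - x₀‖ ≤ ε ^ β := by
      have := ht.2 t ⟨ht.1, le_rfl⟩
      rwa [mem_closedBall, dist_eq_norm] at this
    have hβpos := Real.rpow_pos_of_pos hε0 β
    have h3 : ε ^ 2 * Real.exp (k * t) ≤ (ε ^ β) ^ 2 :=
      h1.trans (pow_le_pow_left₀ (norm_nonneg _) h2 2)
    have h4 := Real.log_le_log (by positivity) h3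
    rw [Real.log_mul (by positivity) (Real.exp_pos _).ne', Real.log_exp, Real.log_pow, Real.log_pow,
      Real.log_rpow hε0] at h4
    push_cast at h4
    have hlog : Real.log ε ≤ 0 := Real.log_nonpos hε0.le hε1.le
    rw [abs_of_nonpos hlog, div_mul_eq_mul_div, le_div_iff₀ hk]
    nlinarith [mul_nonneg hβ.le (neg_nonneg.2 hlog)]
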